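/- Let $L\ge 3$ be an integer and let $\phi:\mathbb R\to\mathbb R$ be differentiable with $\phi(t)=0$ for all $t\notin[0,L]$. Let $\mathcal S(\phi)=\{\sum_{k\in\mathbb Z}c_k\phi(\cdot-k):\ c_k\in\mathbb C\}$. For $\psi\in\{\phi,\phi'\}$ and $x\in(0,1)$ put $\Psi_\psi(x)=(\psi(x),\psi(x+1),\dots,\psi(x+L-1))^T$ and $W_\psi=\mathrm{span}_{\mathbb R}\{\Psi_\psi(x)\Psi_\psi(x)^T:\ 0<x<1\}$, a subspace of the space $\mathbb H_L$ of real symmetric $L\times L$ matrices. Assume that $\phi$ and $\phi'$ each are locally linearly independent on $(0,1)$, that is, for $\psi\in\{\phi,\phi'\}$, if $\sum_k c_k\psi(x-k)=0$ for all $x\in(0,1)$ then $c_k=0$ for every $k$ such that $\psi(\cdot-k)\not\equiv0$ on $(0,1)$; and assume that $W_\phi+W_{\phi'}=\mathbb H_L$. For a sequence $c=(c_k)_{k\in\mathbb Z}$ of complex numbers put $K_-=\inf\{k: c_k\ne0\}$, $K_+=\sup\{k:c_k\neq0\}$; let $\kappa_-$ be the supremum of all $k\in\mathbb Z$ for which there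 is a $\xi_1\in\mathbb C$, $|\xi_1|=1$, with $\Im(\overline{\xi_1}c_l)=0$ for all $l\le k$, and let $\kappa_+$ be the infimum of all integers $k>\kappa_-$ for which there is a $\xi_2\in\mathbb C$, $|\xi_2|=1$, with $\Im(\overline{\xi_2}c_l)=0$ for all $l\ge k$ (all in $[-\infty,\infty]$, with $\inf\emptyset=+\infty$, $\sup\emptyset=-\infty$). Consider the conditions (i) $\sum_{l=0}^{L-2}|c_{k+l}|\ne0$ for all integers $k\in(K_--L+1,\,K_++1)$; (ii) if there is an integer strictly between $\kappa_-$ and $\kappa_+$, then $\sum_{k-L+2\le n_1<n_2\le k}|\Im(c_{n_1}\overline{c_{n_2}})|\neq0$ for all integers $k$ with $\kappa_-+1\le k\le\kappa_++L-3$. Then there are finite sets $\Gamma,\Gamma'\subset(0,1)$ such that every $f=\sum_k c_k\phi(\cdot-k)\in\mathcal S(\phi)$ whose coefficients satisfy (i) and (ii) is determined in $\mathcal S(\phi)$, up to a unimodular constant and conjugation, by its phaseless Hermite samples: if $g\in\mathcal S(\phi)$ satisfies $|g(\gamma+j)|=|f(\gamma+j)|$ and $|g'(\gamma'+j)|=|f'(\gamma'+j)|$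 for all $\gamma\in\Gamma$, $\gamma'\in\Gamma'$, $j\in\mathbb Z$, then there is $z\in\mathbb C$ with $|z|=1$ such that $g=zf$ or $g=z\overline f$ on $\mathbb R$. -/

import Mathlib

namespace ConjPhase

/-- The function `x ↦ ∑_{k ∈ ℤ} c_k φ(x - k)`. For `φ` vanishing outside a bounded interval only
finitely many terms are nonzero at each `x`. -/
noncomputable def shiftSeries (φ : ℝ → ℝ) (c : ℤ → ℂ) (x : ℝ) : ℂ :=
  ∑ᶠ k : ℤ, c k * (φ (x - (k : ℝ)) : ℂ)

/-- The complex shift-invariant space `S(φ)` (arbitrary complex coefficient sequences). -/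
def shiftInvariantSpace (φ : ℝ → ℝ) : Set (ℝ → ℂ) :=
  Set.range (shiftSeries φ)

/-- Local linear independence of (the integer shifts of) `φ` on `A`: if `∑ c_k φ(x - k) = 0` on `A`
then `c_k = 0` for every `k` such that `φ(· - k)` does not vanish identically on `A`. -/
def LocallyLinearIndependent (φ : ℝ → ℝ) (A : Set ℝ) : Prop :=
  ∀ c : ℤ → ℂ, (∀ x ∈ A, shiftSeries φ c x = 0) →
    ∀ k : ℤ, (∃ x ∈ A, φ (x - (k : ℝ)) ≠ 0) → c k = 0

/-- The vector `Φ(x) = (φ(x), φ(x + 1), …, φ(x + L - 1))`. For `φ` vanishing outside `[0, L]` and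
`0 < x < 1` these are the only shifts `φ(x - k)`, `k ∈ ℤ`, that can be nonzero. -/
def shiftVector (φ : ℝ → ℝ) (L : ℕ) (x : ℝ) : Fin L → ℝ :=
  fun m => φ (x + (m : ℕ))

/-- The span `W` of the outer products `Φ(x) Φ(x)ᵀ`, `0 < x < 1`. -/
def outerSpan (φ : ℝ → ℝ) (L : ℕ) : Submodule ℝ (Matrix (Fin L) (Fin L) ℝ) :=
  Submodule.span ℝ
    ((fun x => Matrix.vecMulVec (shiftVector φ L x) (shiftVector φ L x)) '' Set.Ioo 0 1)

/-- The space of real symmetric `L × L` matrices. -/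
def symmMatrices (L : ℕ) : Submodule ℝ (Matrix (Fin L) (Fin L) ℝ) where
  carrier := {A | A.IsSymm}
  add_mem' := fun ha hb => Matrix.IsSymm.add ha hb
  zero_mem' := Matrix.isSymm_zero
  smul_mem' := fun r _ ha => Matrix.IsSymm.smul ha r

/-- An integer as an extended real number. -/
noncomputable def toE (k : ℤ) : EReal := ((k : ℝ) : EReal)

/-- `K₋ = inf {k : c_k ≠ 0}`. -/
noncomputable def KMinus (c : ℤ → ℂ) : EReal := sInf (toE '' {k | c k ≠ 0})

/-- `K₊ = sup {k : c_k ≠ 0}`. -/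
noncomputable def KPlus (c : ℤ → ℂ) : EReal := sSup (toE '' {k | c k ≠ 0})

/-- The entries `c_l`, `l ∈ S`, are real up to one common unimodular factor `ξ`. -/
def RealUpToPhase (c : ℤ → ℂ) (S : Set ℤ) : Prop :=
  ∃ ξ : ℂ, ‖ξ‖ = 1 ∧ ∀ l ∈ S, ((starRingEnd ℂ) ξ * c l).im = 0

/-- `κ₋`: the supremum of all `k` such that `(c_l)_{l ≤ k}` is real up to a unimodular factor. -/
noncomputable def kappaMinus (c : ℤ → ℂ) : EReal :=
  sSup (toE '' {k | RealUpToPhase c (Set.Iic k)})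

/-- `κ₊`: the infimum of all `k > κ₋` such that `(c_l)_{l ≥ k}` is real up to a unimodular
factor. -/
noncomputable def kappaPlus (c : ℤ → ℂ) : EReal :=
  sInf (toE '' {k | kappaMinus c < toE k ∧ RealUpToPhase c (Set.Ici k)})

/-- The set of integers strictly between `κ₋` and `κ₊`. -/
def middleSet (c : ℤ → ℂ) : Set ℤ :=
  {k | kappaMinus c < toE k ∧ toE k < kappaPlus c}

/-- No `L - 1` consecutive coefficients vanish between the first and the last nonzero one. -/
def NoGap (L : ℕ) (c : ℤ → ℂ) : Prop :=
  ∀ k : ℤ, KMinus c - (L : EReal) + 1 < toE k → toE k < KPlus c + 1 →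
    ∑ l ∈ Finset.range (L - 1), ‖c (k + (l : ℤ))‖ ≠ 0

/-- If there are integers strictly between `κ₋` and `κ₊`, then
`∑_{k-L+2 ≤ n₁ < n₂ ≤ k} |Im (c_{n₁} conj c_{n₂})| ≠ 0` whenever `κ₋ + 1 ≤ k ≤ κ₊ + L - 3`. -/
def MiddleNonreal (L : ℕ) (c : ℤ → ℂ) : Prop :=
  (middleSet c).Nonempty →
    ∀ k : ℤ, kappaMinus c + 1 ≤ toE k → toE k ≤ kappaPlus c + (L : EReal) - 3 →
      ∑ n₂ ∈ Finset.Icc (k - (L : ℤ) + 2) k, ∑ n₁ ∈ Finset.Ico (k - (L : ℤ) + 2) n₂,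
        |(c n₁ * (starRingEnd ℂ) (c n₂)).im| ≠ 0

/-- `g` equals `f` up to a unimodular constant and conjugation. -/
def EqUpToPhaseConj (f g : ℝ → ℂ) : Prop :=
  ∃ z : ℂ, ‖z‖ = 1 ∧ ((∀ x, g x = z * f x) ∨ (∀ x, g x = z * (starRingEnd ℂ) (f x)))

end ConjPhase

/-!
For `0 < x < 1` and an integer `j`, the squared modulus of `∑ c_k ψ(· - k)` at `x + j` is a linear
functional of the outer product `Ψ(x) Ψ(x)ᵀ`, with coefficients `Re (c_{j-m} conj c_{j-n})`.
Finitely many outer products span `W_ψ`, so samples at finitely many points (for `ψ = φ` and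
`ψ = φ'` together) fix this functional on all symmetric matrices. Hence the samples of
`f = ∑ c_k φ(· - k)` and `g = ∑ d_k φ(· - k)` agree only if `c` and `d` have the same real inner
products between entries at distance less than `L` (`sameGram_of_gramFunctional`).

It remains to recover a sequence of vectors in the real plane `ℂ`, up to one plane isometry
`w ↦ z w` or `w ↦ z conj w`, from these local Gram matrices. Two vectors are determined by their
Gram matrix up to such a map (`exists_isPhaseMap_of_gram`), and a real linear relation inside a
window of length `L` is visible in the Gram matrix, hence passes from `c` to `d` (`comb_of_gram`).
So an isometry found on a seed window extends to every further entry that is a real combination of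
the `L - 1` entries next to it (`SameGram.propagate`).

Let the left (right) real tail be the set of `k` for which the entries up to (from) `k` lie on one
real line. If some integer is in neither tail, every window that is not inside a tail spans the
plane, and inside a tail a nonzero entry of the window spans the line. If the tails cover the
integers, then either `c` lies on one line, or the tails meet at some `a`, `a + 1` and the window
ending at `a + 1` contains a nonzero entry of each. In all cases one isometry serves the whole
sequence (`SameGram.exists_isPhaseMap`).
-/

namespace ConjPhase

open ComplexConjugate

/-! ### Real linear relations and phase maps -/

/-- A map `ℂ → ℂ` of the form `w ↦ z w` or `w ↦ z conj w` with `|z| = 1`. These are exactly the real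
linear isometries of the plane. -/
def IsPhaseMap (T : ℂ → ℂ) : Prop :=
  ∃ z : ℂ, ‖z‖ = 1 ∧ ((∀ w, T w = z * w) ∨ (∀ w, T w = z * conj w))

theorem IsPhaseMap.map_comb {T : ℂ → ℂ} (hT : IsPhaseMap T) (s t : ℝ) (a b : ℂ) :
    T (s * a + t * b) = s * T a + t * T b := by
  obtain ⟨z, -, h | h⟩ := hT
  · simp only [h]; ring
  · simp only [h, map_add, map_mul, Complex.conj_ofReal]; ring

/-- Two plane vectors are determined by their Gram matrix up to a phase map. -/
theorem exists_isPhaseMap_of_gram {a b a' b' : ℂ} (ha : a ≠ 0)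
    (haa : (a * conj a).re = (a' * conj a').re) (hbb : (b * conj b).re = (b' * conj b').re)
    (hab : (a * conj b).re = (a' * conj b').re) :
    ∃ T, IsPhaseMap T ∧ T a = a' ∧ T b = b' := by
  have hca : conj a ≠ 0 := (map_ne_zero _).2 ha
  have hnorm : ‖a'‖ = ‖a‖ := by
    rw [Complex.mul_conj, Complex.mul_conj, Complex.ofReal_re, Complex.ofReal_re,
      Complex.normSq_eq_norm_sq, Complex.normSq_eq_norm_sq] at haa
    exact (sq_eq_sq₀ (norm_nonneg _) (norm_nonneg _)).1 haa.symm
  have haa' : a' * conj a' = a * conj a := by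
    rw [Complex.mul_conj, Complex.mul_conj, Complex.normSq_eq_norm_sq, Complex.normSq_eq_norm_sq,
      hnorm]
  have hbb' : b' * conj b' = b * conj b := by
    rw [Complex.mul_conj, Complex.mul_conj] at hbb ⊢
    simpa using hbb.symm
  have hna : ‖a‖ ≠ 0 := norm_ne_zero_iff.2 ha
  -- the products `a conj b` and `a' conj b'` have equal real parts and equal moduli
  have him : (a * conj b).im = (a' * conj b').im ∨ (a * conj b).im = -(a' * conj b').im := by
    apply sq_eq_sq_iff_eq_or_eq_neg.1
    have h : Complex.normSq (a * conj b) = Complex.normSq (a' * conj b') := by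
      rw [Complex.normSq_mul, Complex.normSq_mul, Complex.normSq_conj, Complex.normSq_conj]
      have h1 := congrArg Complex.re haa'
      have h2 := congrArg Complex.re hbb'
      simp only [Complex.mul_conj, Complex.ofReal_re] at h1 h2
      rw [h1, h2]
    rw [Complex.normSq_apply, Complex.normSq_apply, hab] at h
    linarith
  rcases him with him | him
  · have h : conj (a' * conj b') = conj (a * conj b) := congrArg conj (Complex.ext hab him).symm
    simp only [map_mul, Complex.conj_conj] at h
    refine ⟨fun w => a' / a * w,
      ⟨a' / a, by rw [norm_div, hnorm, div_self hna], Or.inl fun _ => rfl⟩,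
      div_mul_cancel₀ _ ha, ?_⟩
    change a' / a * b = b'
    rw [div_mul_eq_mul_div, div_eq_iff ha]
    apply mul_left_cancel₀ hca
    linear_combination (-a') * h + b' * haa'
  · have h : conj (a' * conj b') = a * conj b := by
      apply Complex.ext
      · simpa using hab.symm
      · rw [him, Complex.conj_im]
    simp only [map_mul, Complex.conj_conj] at h
    refine ⟨fun w => a' / conj a * conj w,
      ⟨a' / conj a, by rw [norm_div, hnorm, RCLike.norm_conj, div_self hna], Or.inr fun _ => rfl⟩,
      div_mul_cancel₀ _ hca, ?_⟩
    change a' / conj a * conj b = b'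
    rw [div_mul_eq_mul_div, div_eq_iff hca]
    apply mul_left_cancel₀ ha
    linear_combination (-a') * h + b' * haa'

/-- A real linear relation between plane vectors is visible in their Gram matrix. -/
theorem comb_of_gram {a b e a' b' e' : ℂ} {s t : ℝ}
    (haa : (a * conj a).re = (a' * conj a').re) (hbb : (b * conj b).re = (b' * conj b').re)
    (hee : (e * conj e).re = (e' * conj e').re) (hab : (a * conj b).re = (a' * conj b').re)
    (hea : (e * conj a).re = (e' * conj a').re) (heb : (e * conj b).re = (e' * conj b').re)
    (h : e = s * a + t * b) : e' = s * a' + t * b' := by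
  have h1 : Complex.normSq (e - (s * a + t * b)) = 0 := by rw [h, sub_self, map_zero]
  have h2 : Complex.normSq (e' - (s * a' + t * b')) = 0 := by
    rw [← h1]
    simp only [Complex.normSq_apply, Complex.mul_re, Complex.mul_im, Complex.add_re, Complex.add_im,
      Complex.sub_re, Complex.sub_im, Complex.conj_re, Complex.conj_im, Complex.ofReal_re,
      Complex.ofReal_im] at *
    linear_combination (-1) * hee - s ^ 2 * haa - t ^ 2 * hbb + 2 * s * hea + 2 * t * heb
      - 2 * s * t * hab
  exact sub_eq_zero.1 (Complex.normSq_eq_zero.1 h2)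

/-- The `l`-th entry of `c` is a real linear combination of (at most two) entries with index
in `S`. -/
def RealDep (c : ℤ → ℂ) (l : ℤ) (S : Set ℤ) : Prop :=
  ∃ m ∈ S, ∃ n ∈ S, ∃ s t : ℝ, c l = s * c m + t * c n

theorem RealDep.of_eq_mul {c : ℤ → ℂ} {l m : ℤ} {S : Set ℤ} (hm : m ∈ S) {t : ℝ}
    (h : c l = t * c m) : RealDep c l S :=
  ⟨m, hm, m, hm, t, 0, by simp [h]⟩

theorem RealDep.of_im_ne_zero {c : ℤ → ℂ} {m n : ℤ} {S : Set ℤ} (hm : m ∈ S) (hn : n ∈ S)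
    (h : (c m * conj (c n)).im ≠ 0) (l : ℤ) : RealDep c l S := by
  -- Cramer's rule
  refine ⟨m, hm, n, hn, (c l * conj (c n)).im / (c m * conj (c n)).im,
    (c m * conj (c l)).im / (c m * conj (c n)).im, ?_⟩
  have h' : (((c m * conj (c n)).im : ℝ) : ℂ) ≠ 0 := Complex.ofReal_ne_zero.2 h
  rw [Complex.ofReal_div, Complex.ofReal_div, div_mul_eq_mul_div, div_mul_eq_mul_div, ← add_div,
    eq_div_iff h']
  apply Complex.ext <;>
  simp only [Complex.mul_re, Complex.mul_im, Complex.add_re, Complex.add_im, Complex.conj_re,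
    Complex.conj_im, Complex.ofReal_re, Complex.ofReal_im] <;> ring

theorem RealUpToPhase.mono {c : ℤ → ℂ} {S S' : Set ℤ} (h : RealUpToPhase c S) (hS : S' ⊆ S) :
    RealUpToPhase c S' :=
  let ⟨ξ, h1, h2⟩ := h
  ⟨ξ, h1, fun l hl => h2 l (hS hl)⟩

/-- Zero entries can be adjoined to a set of indices without affecting collinearity. -/
theorem RealUpToPhase.extend {c : ℤ → ℂ} {S S' : Set ℤ} (h : RealUpToPhase c S)
    (hS : ∀ l ∈ S', l ∉ S → c l = 0) : RealUpToPhase c S' := by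
  obtain ⟨ξ, h1, h2⟩ := h
  refine ⟨ξ, h1, fun l hl => ?_⟩
  by_cases hlS : l ∈ S
  · exact h2 l hlS
  · simp [hS l hl hlS]

theorem RealUpToPhase.exists_eq_mul {c : ℤ → ℂ} {S : Set ℤ} (h : RealUpToPhase c S) {l n : ℤ}
    (hl : l ∈ S) (hn : n ∈ S) (hcn : c n ≠ 0) : ∃ t : ℝ, c l = t * c n := by
  obtain ⟨ξ, h1, h2⟩ := h
  have hξ : ξ * conj ξ = 1 := by
    rw [Complex.mul_conj, Complex.normSq_eq_norm_sq, h1]; simp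
  have hre : ∀ k ∈ S, ∃ r : ℝ, c k = ξ * r := fun k hk => by
    have : (((conj ξ * c k).re : ℝ) : ℂ) = conj ξ * c k :=
      Complex.ext rfl (by rw [Complex.ofReal_im, h2 k hk])
    exact ⟨(conj ξ * c k).re, by rw [this, ← mul_assoc, hξ, one_mul]⟩
  obtain ⟨r, hr⟩ := hre n hn
  obtain ⟨r', hr'⟩ := hre l hl
  have hr0 : (r : ℂ) ≠ 0 := fun h0 => hcn (by rw [hr, h0, mul_zero])
  refine ⟨r' / r, ?_⟩
  rw [hr, hr', Complex.ofReal_div]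
  field_simp

/-! ### Propagation of a phase map along the coefficient sequence -/

/-- Two sequences with the same real inner products between entries at distance less than `L`. -/
def SameGram (L : ℕ) (c d : ℤ → ℂ) : Prop :=
  ∀ m n : ℤ, |m - n| < L → (c m * conj (c n)).re = (d m * conj (d n)).re

theorem SameGram.eq_of_realDep {L : ℕ} {c d : ℤ → ℂ} (H : SameGram L c d) {T : ℂ → ℂ}
    (hT : IsPhaseMap T) {l : ℤ} {S : Set ℤ} (hS : ∀ m ∈ S, |l - m| < L)
    (hS' : ∀ m ∈ S, ∀ n ∈ S, |m - n| < L) (hd : ∀ m ∈ S, d m = T (c m)) (h : RealDep c l S) :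
    d l = T (c l) := by
  obtain ⟨m, hm, n, hn, s, t, he⟩ := h
  have hl : |l - l| < (L : ℤ) := by
    rw [sub_self, abs_zero]; exact (abs_nonneg _).trans_lt (hS m hm)
  rw [comb_of_gram (H m m (hS' m hm m hm)) (H n n (hS' n hn n hn)) (H l l hl)
    (H m n (hS' m hm n hn)) (H l m (hS m hm)) (H l n (hS n hn)) he, he, hT.map_comb,
    hd m hm, hd n hn]

/-- A phase map carrying `c` to `d` on a seed window `[p, q]` of at least `L - 1` integers does so
everywhere, if each further entry of `c` depends on the `L - 1` entries next to it. -/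
theorem SameGram.propagate {L : ℕ} {c d : ℤ → ℂ} (H : SameGram L c d) {T : ℂ → ℂ}
    (hT : IsPhaseMap T) {p q : ℤ} (hpq : p + L - 2 ≤ q) (hd : ∀ l ∈ Set.Icc p q, d l = T (c l))
    (up : ∀ l, q < l → RealDep c l (Set.Icc (l - L + 1) (l - 1)))
    (down : ∀ l, l < p → RealDep c l (Set.Icc (l + 1) (l + L - 1))) (l : ℤ) : d l = T (c l) := by
  have hup : ∀ k : ℕ, ∀ l ∈ Set.Icc p (q + k), d l = T (c l) := by
    intro k
    induction k with
    | zero => simpa using hd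
    | succ k ih =>
      intro l hl
      simp only [Set.mem_Icc, Nat.cast_add, Nat.cast_one] at hl ih
      by_cases hlk : l ≤ q + k
      · exact ih l ⟨hl.1, hlk⟩
      · refine H.eq_of_realDep hT ?_ ?_ (fun m hm => ih m ?_) (up l (by omega))
        · intro m hm; rw [Set.mem_Icc] at hm; rw [abs_lt]; omega
        · intro m hm n hn; rw [Set.mem_Icc] at hm hn; rw [abs_lt]; omega
        · rw [Set.mem_Icc] at hm; omega
  have hdown : ∀ k : ℕ, ∀ l, p - k ≤ l → d l = T (c l) := by
    intro k
    induction k with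
    | zero =>
      intro l hl
      refine hup (l - q).toNat l ?_
      rw [Set.mem_Icc]; omega
    | succ k ih =>
      intro l hl
      simp only [Nat.cast_add, Nat.cast_one] at hl
      by_cases hlk : p - k ≤ l
      · exact ih l hlk
      · refine H.eq_of_realDep hT ?_ ?_ (fun m hm => ih m ?_) (down l (by omega))
        · intro m hm; rw [Set.mem_Icc] at hm; rw [abs_lt]; omega
        · intro m hm n hn; rw [Set.mem_Icc] at hm hn; rw [abs_lt]; omega
        · rw [Set.mem_Icc] at hm; omega
  exact hdown (p - l).toNat l (by omega)

/-! ### The hypotheses on the coefficients in terms of integers -/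

theorem toE_lt_toE {m n : ℤ} : toE m < toE n ↔ m < n := by
  simp [toE]

theorem toE_le_toE {m n : ℤ} : toE m ≤ toE n ↔ m ≤ n := by
  simp [toE]

/-- A window of `L - 1` consecutive integers that ends at or after `m` and starts at or before `m'`
contains a nonzero entry, if `c m` and `c m'` are nonzero. -/
theorem NoGap.exists_ne_zero {L : ℕ} {c : ℤ → ℂ} (h : NoGap L c) {m m' k : ℤ} (hm : c m ≠ 0)
    (hm' : c m' ≠ 0) (h1 : m < k + L - 1) (h2 : k ≤ m') :
    ∃ n ∈ Set.Icc k (k + L - 2), c n ≠ 0 := by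
  have hlow : KMinus c ≤ toE m := sInf_le ⟨m, hm, rfl⟩
  have hupp : toE m' ≤ KPlus c := le_sSup ⟨m', hm', rfl⟩
  have e1 : toE m - (L : EReal) + 1 = toE (m - L + 1) := by
    simp only [toE]; push_cast; rfl
  have e2 : toE m' + 1 = toE (m' + 1) := by
    simp only [toE]; push_cast; rfl
  have h3 : KMinus c - (L : EReal) + 1 < toE k := by
    refine lt_of_le_of_lt (b := toE m - (L : EReal) + 1)
      (add_le_add (EReal.sub_le_sub hlow le_rfl) le_rfl) ?_
    rw [e1, toE_lt_toE]; omega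
  have h4 : toE k < KPlus c + 1 := by
    refine lt_of_lt_of_le (b := toE m' + 1) ?_ (add_le_add hupp le_rfl)
    rw [e2, toE_lt_toE]; omega
  obtain ⟨l, hl, hne⟩ := Finset.exists_ne_zero_of_sum_ne_zero (h k h3 h4)
  rw [Finset.mem_range] at hl
  refine ⟨k + l, ?_, norm_ne_zero_iff.1 hne⟩
  rw [Set.mem_Icc]; omega

theorem toE_le_kappaMinus {c : ℤ → ℂ} {k : ℤ} (h : RealUpToPhase c (Set.Iic k)) :
    toE k ≤ kappaMinus c :=
  le_sSup ⟨k, h, rfl⟩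

/-- The set defining `κ₋` is a lower set of integers, so missing `k` bounds its supremum by
`k - 1`. -/
theorem kappaMinus_le {c : ℤ → ℂ} {k : ℤ} (h : ¬ RealUpToPhase c (Set.Iic k)) :
    kappaMinus c ≤ toE (k - 1) := by
  refine sSup_le ?_
  rintro _ ⟨k', hk', rfl⟩
  rw [toE_le_toE]
  by_contra hlt
  exact h (RealUpToPhase.mono hk' (Set.Iic_subset_Iic.2 (by omega)))

/-- The integers competing for `κ₊` form an upper set: those outside the left real tail and inside
the right one. -/
theorem le_kappaPlus {c : ℤ → ℂ} {k : ℤ}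
    (h : RealUpToPhase c (Set.Iic k) ∨ ¬ RealUpToPhase c (Set.Ici k)) :
    toE (k + 1) ≤ kappaPlus c := by
  refine le_sInf ?_
  rintro _ ⟨k', ⟨hk1, hk2⟩, rfl⟩
  rw [toE_le_toE]
  rcases h with h | h
  · have := toE_lt_toE.1 ((toE_le_kappaMinus h).trans_lt hk1)
    omega
  · by_contra hlt
    exact h (RealUpToPhase.mono hk2 (Set.Ici_subset_Ici.2 (by omega)))

theorem mem_middleSet {c : ℤ → ℂ} {k : ℤ} (h : ¬ RealUpToPhase c (Set.Iic k))
    (h' : ¬ RealUpToPhase c (Set.Ici k)) : k ∈ middleSet c :=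
  ⟨(kappaMinus_le h).trans_lt (toE_lt_toE.2 (by omega)),
    (toE_lt_toE.2 (by omega)).trans_le (le_kappaPlus (Or.inr h'))⟩

theorem MiddleNonreal.exists_im_ne_zero {L : ℕ} {c : ℤ → ℂ} (h : MiddleNonreal L c)
    (hne : (middleSet c).Nonempty) {k : ℤ} (h1 : ¬ RealUpToPhase c (Set.Iic k))
    (h2 : RealUpToPhase c (Set.Iic (k - L + 2)) ∨ ¬ RealUpToPhase c (Set.Ici (k - L + 2))) :
    ∃ m ∈ Set.Icc (k - L + 2) k, ∃ n ∈ Set.Icc (k - L + 2) k, (c m * conj (c n)).im ≠ 0 := by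
  have e1 : toE (k - 1) + 1 = toE k := by
    simp only [toE]; norm_cast; simp
  have e2 : toE (k - L + 2 + 1) + (L : EReal) - 3 = toE k := by
    have : (((((k - L + 2 + 1 : ℤ) : ℝ) + (L : ℝ) - 3 : ℝ)) : EReal) = ((k : ℝ) : EReal) := by
      congr 1; push_cast; ring
    simp only [toE]; rw [← this]; push_cast; rfl
  have h3 : kappaMinus c + 1 ≤ toE k := by
    rw [← e1]; exact add_le_add (kappaMinus_le h1) le_rfl
  have h4 : toE k ≤ kappaPlus c + (L : EReal) - 3 := by
    rw [← e2]; exact EReal.sub_le_sub (add_le_add (le_kappaPlus h2) le_rfl) le_rfl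
  obtain ⟨n, hn, hs⟩ := Finset.exists_ne_zero_of_sum_ne_zero (h hne k h3 h4)
  obtain ⟨m, hm, hs⟩ := Finset.exists_ne_zero_of_sum_ne_zero hs
  rw [Finset.mem_Icc] at hn
  rw [Finset.mem_Ico] at hm
  exact ⟨m, ⟨hm.1, by omega⟩, n, hn, abs_ne_zero.1 hs⟩

/-! ### Conjugate phase retrieval for coefficient sequences -/

/-- Along a collinear stretch, an entry to the right of some nonzero entry depends on the `L - 1`
entries before it: either it vanishes, or the absence of gaps puts a nonzero entry among them. -/
theorem NoGap.realDep_up {L : ℕ} (hL : 3 ≤ L) {c : ℤ → ℂ} (h : NoGap L c) {l m : ℤ} (hm : c m ≠ 0)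
    (hml : m < l) (hr : RealUpToPhase c (Set.Icc (l - L + 1) l)) :
    RealDep c l (Set.Icc (l - L + 1) (l - 1)) := by
  by_cases hl : c l = 0
  · exact RealDep.of_eq_mul (m := l - 1) (t := 0) (by rw [Set.mem_Icc]; omega) (by simp [hl])
  · obtain ⟨n, hn, hcn⟩ := h.exists_ne_zero (k := l - L + 1) hm hl (by omega) (by omega)
    rw [Set.mem_Icc] at hn
    obtain ⟨t, ht⟩ := hr.exists_eq_mul (l := l) (n := n) (by rw [Set.mem_Icc]; omega)
      (by rw [Set.mem_Icc]; omega) hcn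
    exact RealDep.of_eq_mul (by rw [Set.mem_Icc]; omega) ht

theorem NoGap.realDep_down {L : ℕ} (hL : 3 ≤ L) {c : ℤ → ℂ} (h : NoGap L c) {l m : ℤ}
    (hm : c m ≠ 0) (hml : l < m) (hr : RealUpToPhase c (Set.Icc l (l + L - 1))) :
    RealDep c l (Set.Icc (l + 1) (l + L - 1)) := by
  by_cases hl : c l = 0
  · exact RealDep.of_eq_mul (m := l + 1) (t := 0) (by rw [Set.mem_Icc]; omega) (by simp [hl])
  · obtain ⟨n, hn, hcn⟩ := h.exists_ne_zero (k := l + 1) hl hm (by omega) (by omega)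
    rw [Set.mem_Icc] at hn
    obtain ⟨t, ht⟩ := hr.exists_eq_mul (l := l) (n := n) (by rw [Set.mem_Icc]; omega)
      (by rw [Set.mem_Icc]; omega) hcn
    exact RealDep.of_eq_mul (by rw [Set.mem_Icc]; omega) ht

/-- The case of an index lying in neither real tail. The window ending at that index spans the plane
and serves as seed. Windows between the tails span the plane, so they determine the next entry;
inside a tail the next entry is collinear with a nonzero one. -/
theorem SameGram.exists_isPhaseMap_of_middle {L : ℕ} (hL : 3 ≤ L) {c d : ℤ → ℂ}
    (H : SameGram L c d) (hgap : NoGap L c) (hmid : MiddleNonreal L c) {k : ℤ}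
    (hA : ¬ RealUpToPhase c (Set.Iic k)) (hB : ¬ RealUpToPhase c (Set.Ici k)) :
    ∃ T, IsPhaseMap T ∧ ∀ l, d l = T (c l) := by
  have hne : (middleSet c).Nonempty := ⟨k, mem_middleSet hA hB⟩
  have hA' : ∀ l, k ≤ l → ¬ RealUpToPhase c (Set.Iic l) := fun l hl h =>
    hA (h.mono (Set.Iic_subset_Iic.2 hl))
  have hB' : ∀ l, l ≤ k → ¬ RealUpToPhase c (Set.Ici l) := fun l hl h =>
    hB (h.mono (Set.Ici_subset_Ici.2 hl))
  obtain ⟨m, hm, n, hn, hmn⟩ :=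
    hmid.exists_im_ne_zero hne hA (Or.inr (hB' (k - L + 2) (by omega)))
  have hcm : c m ≠ 0 := fun h => hmn (by simp [h])
  rw [Set.mem_Icc] at hm hn
  obtain ⟨T, hT, hTm, hTn⟩ := exists_isPhaseMap_of_gram hcm (H m m (by simp; omega))
    (H n n (by simp; omega)) (H m n (by rw [abs_lt]; omega))
  refine ⟨T, hT, H.propagate hT (p := k - L + 2) (q := k) (by omega) (fun l hl => ?_)
    (fun l hl => ?_) (fun l hl => ?_)⟩
  · rw [Set.mem_Icc] at hl
    refine H.eq_of_realDep hT (S := {m, n}) ?_ ?_ ?_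
      (RealDep.of_im_ne_zero (by simp) (by simp) hmn l)
    · rintro x (rfl | rfl) <;> rw [abs_lt] <;> omega
    · rintro x (rfl | rfl) y (rfl | rfl) <;> rw [abs_lt] <;> omega
    · rintro x (rfl | rfl)
      · exact hTm.symm
      · exact hTn.symm
  · by_cases hr : RealUpToPhase c (Set.Ici (l - L + 1))
    · exact hgap.realDep_up hL hcm (by omega) (hr.mono fun x hx => hx.1)
    · obtain ⟨i, hi, j, hj, hij⟩ := hmid.exists_im_ne_zero hne (k := l - 1) (hA' _ (by omega))
        (Or.inr (by rwa [show l - 1 - (L : ℤ) + 2 = l - L + 1 by ring]))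
      rw [show l - 1 - (L : ℤ) + 2 = l - L + 1 by ring] at hi hj
      exact RealDep.of_im_ne_zero hi hj hij l
  · by_cases hr : RealUpToPhase c (Set.Iic (l + L - 1))
    · exact hgap.realDep_down hL hcm (by omega) (hr.mono fun x hx => hx.2)
    · have e : l + L - 1 - (L : ℤ) + 2 = l + 1 := by ring
      obtain ⟨i, hi, j, hj, hij⟩ := hmid.exists_im_ne_zero hne (k := l + L - 1) hr
        (Or.inr (by rw [e]; exact hB' _ (by omega)))
      rw [e] at hi hj
      exact RealDep.of_im_ne_zero hi hj hij l

theorem SameGram.exists_isPhaseMap_of_collinear {L : ℕ} (hL : 3 ≤ L) {c d : ℤ → ℂ}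
    (H : SameGram L c d) (hgap : NoGap L c) {m : ℤ} (hm : c m ≠ 0)
    (hr : ∀ i j : ℤ, RealUpToPhase c (Set.Icc i j)) :
    ∃ T, IsPhaseMap T ∧ ∀ l, d l = T (c l) := by
  have hmm := H m m (by simp; omega)
  obtain ⟨T, hT, hTm, -⟩ := exists_isPhaseMap_of_gram hm hmm hmm hmm
  refine ⟨T, hT, H.propagate hT (p := m - L + 2) (q := m) (by omega) (fun l hl => ?_)
    (fun l hl => hgap.realDep_up hL hm hl (hr _ _))
    (fun l hl => hgap.realDep_down hL hm (by omega) (hr _ _))⟩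
  rw [Set.mem_Icc] at hl
  obtain ⟨t, ht⟩ := (hr l m).exists_eq_mul (l := l) (n := m) ⟨le_rfl, hl.2⟩ ⟨hl.2, le_rfl⟩ hm
  refine H.eq_of_realDep hT (S := {m}) ?_ ?_ ?_ (RealDep.of_eq_mul rfl ht)
  · rintro x rfl; rw [abs_lt]; omega
  · rintro x rfl y rfl; rw [abs_lt]; omega
  · rintro x rfl; exact hTm.symm

/-- The case of two real tails that meet. The seed window ends at `a + 1` and so contains a nonzero
entry from each tail. -/
theorem SameGram.exists_isPhaseMap_of_adjacent {L : ℕ} (hL : 3 ≤ L) {c d : ℤ → ℂ}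
    (H : SameGram L c d) (hgap : NoGap L c) {a m : ℤ} (hA : RealUpToPhase c (Set.Iic a))
    (hB : RealUpToPhase c (Set.Ici (a + 1))) (ha : c (a + 1) ≠ 0) (hma : m ≤ a) (hm : c m ≠ 0) :
    ∃ T, IsPhaseMap T ∧ ∀ l, d l = T (c l) := by
  obtain ⟨n, hn, hcn⟩ := hgap.exists_ne_zero (k := a - L + 2) hm ha (by omega) (by omega)
  rw [Set.mem_Icc] at hn
  obtain ⟨T, hT, hTn, hTa⟩ := exists_isPhaseMap_of_gram hcn (H n n (by simp; omega))
    (H (a + 1) (a + 1) (by simp; omega)) (H n (a + 1) (by rw [abs_lt]; omega))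
  refine ⟨T, hT, H.propagate hT (p := a - L + 2) (q := a + 1) (by omega) (fun l hl => ?_)
    (fun l hl => ?_) (fun l hl => ?_)⟩
  · rw [Set.mem_Icc] at hl
    rcases hl.2.eq_or_lt with rfl | hla
    · exact hTa.symm
    · obtain ⟨t, ht⟩ := hA.exists_eq_mul (l := l) (n := n) (by rw [Set.mem_Iic]; omega)
        (by rw [Set.mem_Iic]; omega) hcn
      refine H.eq_of_realDep hT (S := {n}) ?_ ?_ ?_ (RealDep.of_eq_mul rfl ht)
      · rintro x rfl; rw [abs_lt]; omega
      · rintro x rfl y rfl; rw [abs_lt]; omega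
      · rintro x rfl; exact hTn.symm
  · by_cases hla : a + 1 < l - L + 1
    · exact hgap.realDep_up hL ha hl (hB.mono fun x hx => by rw [Set.mem_Ici]; linarith [hx.1])
    · obtain ⟨t, ht⟩ := hB.exists_eq_mul (l := l) (n := a + 1) (by rw [Set.mem_Ici]; omega)
        (by rw [Set.mem_Ici]) ha
      exact RealDep.of_eq_mul (by rw [Set.mem_Icc]; omega) ht
  · exact hgap.realDep_down hL hcn (by omega)
      (hA.mono fun x hx => by rw [Set.mem_Iic]; linarith [hx.2])

/-- A sequence satisfying both coefficient conditions is determined, up to a phase map, by its inner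
products at distance less than `L`. -/
theorem SameGram.exists_isPhaseMap {L : ℕ} (hL : 3 ≤ L) {c d : ℤ → ℂ}
    (H : SameGram L c d) (hgap : NoGap L c) (hmid : MiddleNonreal L c) :
    ∃ T, IsPhaseMap T ∧ ∀ l, d l = T (c l) := by
  by_cases hzero : ∀ l, c l = 0
  · refine ⟨fun w => 1 * w, ⟨1, norm_one, Or.inl fun _ => rfl⟩, fun l => ?_⟩
    have h := H l l (by simp; omega)
    rw [hzero l, zero_mul, Complex.zero_re, Complex.mul_conj, Complex.ofReal_re] at h
    rw [hzero l, Complex.normSq_eq_zero.1 h.symm]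
    exact (mul_zero 1).symm
  obtain ⟨m, hm⟩ := not_forall.1 hzero
  by_cases hk : ∃ k, ¬ RealUpToPhase c (Set.Iic k) ∧ ¬ RealUpToPhase c (Set.Ici k)
  · obtain ⟨k, hA, hB⟩ := hk
    exact H.exists_isPhaseMap_of_middle hL hgap hmid hA hB
  have hAB : ∀ k, ¬ RealUpToPhase c (Set.Iic k) → RealUpToPhase c (Set.Ici k) := fun k hA =>
    not_not.1 fun hB => hk ⟨k, hA, hB⟩
  by_cases hAll : ∀ k, RealUpToPhase c (Set.Iic k)
  · exact H.exists_isPhaseMap_of_collinear hL hgap hm fun i j => (hAll j).mono fun x hx => hx.2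
  by_cases hBll : ∀ k, RealUpToPhase c (Set.Ici k)
  · exact H.exists_isPhaseMap_of_collinear hL hgap hm fun i j => (hBll i).mono fun x hx => hx.1
  obtain ⟨b, hb⟩ := not_forall.1 hBll
  have hbA : RealUpToPhase c (Set.Iic b) := not_not.1 fun h => hb (hAB b h)
  -- the right end of the left real tail
  obtain ⟨a, haA, ha1⟩ :
      ∃ a, RealUpToPhase c (Set.Iic a) ∧ ¬ RealUpToPhase c (Set.Iic (a + 1)) := by
    by_contra hcon
    push Not at hcon
    refine hAll fun k => ?_
    have : ∀ n : ℕ, RealUpToPhase c (Set.Iic (b + n)) := by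
      intro n
      induction n with
      | zero => simpa using hbA
      | succ n ih => simpa [add_assoc] using hcon _ ih
    exact (this (k - b).toNat).mono (Set.Iic_subset_Iic.2 (by omega))
  have haB := hAB _ ha1
  have hca : c (a + 1) ≠ 0 := fun h0 => ha1 <| haA.extend fun l hl hl' => by
    rw [Set.mem_Iic] at hl hl'
    rwa [show l = a + 1 by omega]
  obtain ⟨i, hia, hi⟩ : ∃ i ≤ a, c i ≠ 0 := by
    by_contra hcon
    push Not at hcon
    refine hb (haB.extend fun l _ hl' => hcon l ?_)
    rw [Set.mem_Ici] at hl'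
    omega
  exact H.exists_isPhaseMap_of_adjacent hL hgap haA haB hca hia hi

/-! ### From samples to Gram data -/

/-- On `(j, j + 1)` only `L` shifts contribute to the series. -/
theorem shiftSeries_add_int {L : ℕ} {φ : ℝ → ℝ}
    (hsupp : ∀ t, t ∉ Set.Icc (0 : ℝ) (L : ℝ) → φ t = 0) (c : ℤ → ℂ) {x : ℝ}
    (hx : x ∈ Set.Ioo (0 : ℝ) 1) (j : ℤ) :
    shiftSeries φ c (x + j) = ∑ m : Fin L, c (j - (m : ℕ)) * (shiftVector φ L x m : ℂ) := by
  have hinj : Function.Injective fun m : Fin L => j - ((m : ℕ) : ℤ) := fun m n h => by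
    apply Fin.ext
    simp only at h
    omega
  rw [shiftSeries, finsum_eq_sum_of_support_subset (s := Finset.univ.map ⟨_, hinj⟩), Finset.sum_map]
  · refine Finset.sum_congr rfl fun m _ => ?_
    simp only [Function.Embedding.coeFn_mk, shiftVector]
    congr 3
    push_cast
    ring
  · intro k hk
    have hne : φ (x + j - k) ≠ 0 := fun h0 => hk (by simp [h0])
    have hmem : x + j - k ∈ Set.Icc (0 : ℝ) L := not_not.1 fun h => hne (hsupp _ h)
    have h1 : (-1 : ℝ) < ((j - k : ℤ) : ℝ) := by push_cast; linarith [hmem.1, hx.2]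
    have h2 : ((j - k : ℤ) : ℝ) < L := by push_cast; linarith [hmem.2, hx.1]
    have h1' : -1 < j - k := by exact_mod_cast h1
    have h2' : j - k < L := by exact_mod_cast h2
    simp only [Finset.coe_map, Finset.coe_univ, Set.image_univ, Set.mem_range,
      Function.Embedding.coeFn_mk]
    exact ⟨⟨(j - k).toNat, by omega⟩, by simp only; omega⟩

theorem deriv_eq_zero_of_support {L : ℕ} {φ : ℝ → ℝ}
    (hsupp : ∀ t, t ∉ Set.Icc (0 : ℝ) (L : ℝ) → φ t = 0) {t : ℝ}
    (ht : t ∉ Set.Icc (0 : ℝ) (L : ℝ)) : deriv φ t = 0 := by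
  have h : φ =ᶠ[nhds t] fun _ => 0 := by
    filter_upwards [isClosed_Icc.isOpen_compl.mem_nhds ht] with s hs using hsupp s hs
  rw [h.deriv_eq, deriv_const]

/-- Away from the integers, a shift series can be differentiated termwise. -/
theorem deriv_shiftSeries_add_int {L : ℕ} {φ : ℝ → ℝ} (hφ : Differentiable ℝ φ)
    (hsupp : ∀ t, t ∉ Set.Icc (0 : ℝ) (L : ℝ) → φ t = 0) (c : ℤ → ℂ) {x : ℝ}
    (hx : x ∈ Set.Ioo (0 : ℝ) 1) (j : ℤ) :
    deriv (shiftSeries φ c) (x + j) = shiftSeries (deriv φ) c (x + j) := by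
  rw [shiftSeries_add_int (fun t => deriv_eq_zero_of_support hsupp) c hx j]
  have heq : shiftSeries φ c =ᶠ[nhds (x + j)] fun y =>
      ∑ m : Fin L, c (j - (m : ℕ)) * (φ (y - j + (m : ℕ)) : ℂ) := by
    have hopen : Set.Ioo (j : ℝ) (j + 1) ∈ nhds (x + j) :=
      Ioo_mem_nhds (by linarith [hx.1]) (by linarith [hx.2])
    filter_upwards [hopen] with y hy
    have := shiftSeries_add_int hsupp c (x := y - j) ⟨by linarith [hy.1], by linarith [hy.2]⟩ j
    rwa [sub_add_cancel] at this
  rw [heq.deriv_eq]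
  refine HasDerivAt.deriv (HasDerivAt.fun_sum fun m _ => HasDerivAt.const_mul _ ?_)
  refine HasDerivAt.ofReal_comp (f := fun y => φ (y - j + (m : ℕ))) ?_
  have h := (hφ (x + (m : ℕ))).hasDerivAt
  rw [show x + ((m : ℕ) : ℝ) = x + j - j + (m : ℕ) by ring] at h
  have h2 := h.comp (x + j)
    (((hasDerivAt_id (x + (j : ℝ))).sub_const (j : ℝ)).add_const ((m : ℕ) : ℝ))
  simpa [shiftVector, Function.comp_def] using h2

/-- Finitely many points of `(0, 1)` already produce the whole span of outer products. -/
theorem exists_finset_span_eq_outerSpan (ψ : ℝ → ℝ) (L : ℕ) :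
    ∃ Γ : Finset ℝ, (Γ : Set ℝ) ⊆ Set.Ioo 0 1 ∧ outerSpan ψ L = Submodule.span ℝ
      ((fun x => Matrix.vecMulVec (shiftVector ψ L x) (shiftVector ψ L x)) '' Γ) := by
  classical
  obtain ⟨s, hs, hspan⟩ := (Submodule.fg_span_iff_fg_span_finset_subset _).1
    (IsNoetherian.noetherian (outerSpan ψ L))
  obtain ⟨Γ, hΓ, rfl⟩ := Finset.subset_set_image_iff.1 hs
  refine ⟨Γ, hΓ, ?_⟩
  rw [Finset.coe_image] at hspan
  exact hspan

/-- The functional `A ↦ ∑ A_{mn} Re (c_{j-m} conj c_{j-n})`. Its value at `Ψ(x) Ψ(x)ᵀ` is the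
squared modulus of the sample of `∑ c_k ψ(· - k)` at `x + j`. -/
noncomputable def gramFunctional (L : ℕ) (c : ℤ → ℂ) (j : ℤ) :
    Matrix (Fin L) (Fin L) ℝ →ₗ[ℝ] ℝ where
  toFun A := ∑ m, ∑ n, A m n * (c (j - (m : ℕ)) * conj (c (j - (n : ℕ)))).re
  map_add' A B := by simp only [Matrix.add_apply, add_mul, Finset.sum_add_distrib]
  map_smul' r A := by
    simp only [Matrix.smul_apply, smul_eq_mul, mul_assoc, Finset.mul_sum, RingHom.id_apply]

theorem gramFunctional_vecMulVec {L : ℕ} {ψ : ℝ → ℝ}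
    (hsupp : ∀ t, t ∉ Set.Icc (0 : ℝ) (L : ℝ) → ψ t = 0) (c : ℤ → ℂ) {x : ℝ}
    (hx : x ∈ Set.Ioo (0 : ℝ) 1) (j : ℤ) :
    gramFunctional L c j (Matrix.vecMulVec (shiftVector ψ L x) (shiftVector ψ L x)) =
      ‖shiftSeries ψ c (x + j)‖ ^ 2 := by
  rw [← Complex.normSq_eq_norm_sq, ← Complex.ofReal_re (Complex.normSq _), ← Complex.mul_conj,
    shiftSeries_add_int hsupp c hx j, map_sum (starRingEnd ℂ), Finset.sum_mul_sum, Complex.re_sum]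
  simp only [gramFunctional, LinearMap.coe_mk, AddHom.coe_mk]
  refine Finset.sum_congr rfl fun m _ => ?_
  rw [Complex.re_sum]
  refine Finset.sum_congr rfl fun n _ => ?_
  rw [Matrix.vecMulVec_apply, map_mul, Complex.conj_ofReal, mul_mul_mul_comm, ← Complex.ofReal_mul,
    Complex.re_mul_ofReal, mul_comm]

/-- If the functionals of `c` and `d` agree on symmetric matrices, then testing them against
`E_{mn} + E_{nm}` recovers the inner products. -/
theorem sameGram_of_gramFunctional {L : ℕ} {c d : ℤ → ℂ}
    (h : ∀ j, ∀ A ∈ symmMatrices L, gramFunctional L c j A = gramFunctional L d j A) :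
    SameGram L c d := by
  have key : ∀ (c : ℤ → ℂ) (j : ℤ) (m n : Fin L),
      gramFunctional L c j (Matrix.single m n 1 + Matrix.single n m 1) =
        2 * (c (j - (m : ℕ)) * conj (c (j - (n : ℕ)))).re := by
    intro c j m n
    have hs : ∀ m n : Fin L, gramFunctional L c j (Matrix.single m n 1) =
        (c (j - (m : ℕ)) * conj (c (j - (n : ℕ)))).re := by
      intro m n
      simp only [gramFunctional, LinearMap.coe_mk, AddHom.coe_mk]
      rw [Finset.sum_eq_single m, Finset.sum_eq_single n, Matrix.single_apply_same, one_mul]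
      · intro b _ hb; simp [hb.symm]
      · simp
      · intro b _ hb; simp [hb.symm]
      · simp
    rw [map_add, hs, hs, two_mul]
    congr 1
    simp only [Complex.mul_re, Complex.conj_re, Complex.conj_im]
    ring
  intro m n hmn
  rw [abs_lt] at hmn
  have hsymm : ∀ a b : Fin L, Matrix.single a b (1 : ℝ) + Matrix.single b a 1 ∈ symmMatrices L := by
    intro a b
    change Matrix.IsSymm _
    rw [Matrix.IsSymm, Matrix.transpose_add, Matrix.transpose_single, Matrix.transpose_single,
      add_comm]
  have h1 := h (max m n) _
    (hsymm ⟨(max m n - m).toNat, by omega⟩ ⟨(max m n - n).toNat, by omega⟩)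
  rw [key, key] at h1
  simp only at h1
  rw [show max m n - ((max m n - m).toNat : ℤ) = m by omega,
    show max m n - ((max m n - n).toNat : ℤ) = n by omega] at h1
  linarith

theorem gramFunctional_eq_of_samples {L : ℕ} {ψ : ℝ → ℝ}
    (hsupp : ∀ t, t ∉ Set.Icc (0 : ℝ) (L : ℝ) → ψ t = 0) {c d : ℤ → ℂ} {Γ : Finset ℝ}
    (hΓ : (Γ : Set ℝ) ⊆ Set.Ioo 0 1) (hspan : outerSpan ψ L = Submodule.span ℝ
      ((fun x => Matrix.vecMulVec (shiftVector ψ L x) (shiftVector ψ L x)) '' Γ)) {j : ℤ}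
    (h : ∀ γ ∈ Γ, ‖shiftSeries ψ d (γ + j)‖ = ‖shiftSeries ψ c (γ + j)‖) :
    outerSpan ψ L ≤ LinearMap.eqLocus (gramFunctional L c j) (gramFunctional L d j) := by
  rw [hspan, Submodule.span_le]
  rintro _ ⟨γ, hγ, rfl⟩
  rw [SetLike.mem_coe, LinearMap.mem_eqLocus, gramFunctional_vecMulVec hsupp c (hΓ hγ),
    gramFunctional_vecMulVec hsupp d (hΓ hγ), h γ hγ]

theorem eqUpToPhaseConj_shiftSeries {φ : ℝ → ℝ} {c d : ℤ → ℂ} {T : ℂ → ℂ} (hT : IsPhaseMap T)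
    (h : ∀ l, d l = T (c l)) : EqUpToPhaseConj (shiftSeries φ c) (shiftSeries φ d) := by
  obtain ⟨z, hz, hT | hT⟩ := hT
  · refine ⟨z, hz, Or.inl fun x => ?_⟩
    simp only [shiftSeries, mul_finsum, h, hT, mul_assoc]
  · refine ⟨z, hz, Or.inr fun x => ?_⟩
    have hconj : conj (shiftSeries φ c x) = ∑ᶠ k : ℤ, conj (c k * (φ (x - (k : ℝ)) : ℂ)) :=
      AddEquiv.map_finsum (starAddEquiv (R := ℂ)) _
    simp only [hconj, mul_finsum, map_mul, Complex.conj_ofReal]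
    simp only [shiftSeries, h, hT, mul_assoc]

end ConjPhase

theorem mainTheorem5 (L : ℕ) (hL : 3 ≤ L) (φ : ℝ → ℝ) (hφ : Differentiable ℝ φ)
    (hsupp : ∀ t, t ∉ Set.Icc (0 : ℝ) (L : ℝ) → φ t = 0)
    (hind : ConjPhase.LocallyLinearIndependent φ (Set.Ioo 0 1))
    (hind' : ConjPhase.LocallyLinearIndependent (deriv φ) (Set.Ioo 0 1))
    (hspan : ConjPhase.outerSpan φ L ⊔ ConjPhase.outerSpan (deriv φ) L =
      ConjPhase.symmMatrices L) :
    ∃ Γ Γ' : Finset ℝ, (Γ : Set ℝ) ⊆ Set.Ioo 0 1 ∧ (Γ' : Set ℝ) ⊆ Set.Ioo 0 1 ∧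
      ∀ (f : ℝ → ℂ) (c : ℤ → ℂ), f = ConjPhase.shiftSeries φ c →
        ConjPhase.NoGap L c → ConjPhase.MiddleNonreal L c →
        ∀ g ∈ ConjPhase.shiftInvariantSpace φ,
          (∀ γ ∈ Γ, ∀ j : ℤ, ‖g (γ + j)‖ = ‖f (γ + j)‖) →
          (∀ γ' ∈ Γ', ∀ j : ℤ, ‖deriv g (γ' + j)‖ = ‖deriv f (γ' + j)‖) →
          ConjPhase.EqUpToPhaseConj f g := by
  obtain ⟨Γ, hΓ, hΓspan⟩ := ConjPhase.exists_finset_span_eq_outerSpan φ L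
  obtain ⟨Γ', hΓ', hΓspan'⟩ := ConjPhase.exists_finset_span_eq_outerSpan (deriv φ) L
  refine ⟨Γ, Γ', hΓ, hΓ', ?_⟩
  rintro _ c rfl hgap hmid _ ⟨d, rfl⟩ hval hder
  have hgram : ConjPhase.SameGram L c d := ConjPhase.sameGram_of_gramFunctional fun j => by
    have h := sup_le
      (ConjPhase.gramFunctional_eq_of_samples hsupp hΓ hΓspan fun γ hγ => hval γ hγ j)
      (ConjPhase.gramFunctional_eq_of_samples
        (fun t => ConjPhase.deriv_eq_zero_of_support hsupp) hΓ' hΓspan' fun γ hγ => by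
          rw [← ConjPhase.deriv_shiftSeries_add_int hφ hsupp d (hΓ' hγ),
            ← ConjPhase.deriv_shiftSeries_add_int hφ hsupp c (hΓ' hγ)]
          exact hder γ hγ j)
    rw [hspan] at h
    exact fun A hA => h hA
  obtain ⟨T, hT, hd⟩ := hgram.exists_isPhaseMap hL hgap hmid
  exact ConjPhase.eqUpToPhaseConj_shiftSeries hT hd
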